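/- Let $h$ be the real vector space of Hermitian $2\times 2$ complex matrices, identified with Minkowski space $\mathbb{R}^{1,3}$ (metric $\mathrm{diag}(-1,1,1,1)$) by $(t,x,y,z)\leftrightarrow\begin{pmatrix} t+z & x+iy\\ x-iy & t-z\end{pmatrix}$. Let $SO^+(1,3)\subset GL(4,\mathbb{R})$ be the identity component of the Lorentz group $\{\Lambda : \Lambda^{T}\eta\Lambda=\eta\}$, $\eta=\mathrm{diag}(-1,1,1,1)$. For every $A\in SL(2,\mathbb{C})$ the linear map $X\mapsto A^\dagger XA$ on $h\cong\mathbb{R}^{1,3}$ is given by a matrix $p(A)\in SO^+(1,3)$. The map $p:SL(2,\mathbb{C})\to SO^+(1,3)$ is smooth and surjective, satisfies $p(I)=I$ and $p(AB)=p(B)p(A)$, and $p(A)=I$ if and only if $A=\pm I$. The space $SL(2,\mathbb{C})$ is simply connected, and $p$ is a covering map and a local diffeomorphism, so that $p$ is a universal cover of $SO^+(1,3)$. Moreover $\varphi(A)=p(A^\dagger)$, that is, the action $X\mapsto AXA^\dagger$, is a surjective smooth group homomorphism $\varphi:SL(2,\mathbb{C})\to SO^+(1,3)$ with kernel $\{\pm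 I\}$, and it too is a covering map and a local diffeomorphism; hence $(SL(2,\mathbb{C}),\varphi)$ is the universal covering group of $SO^+(1,3)$. -/

import Mathlib

open scoped Matrix ContDiff

noncomputable section

namespace SpinCover

/-- The group `SL(2, ℂ)`, with Mathlib's group structure and topology. -/
abbrev SL2C : Type := Matrix.SpecialLinearGroup (Fin 2) ℂ

/-- The real vector space `h` of Hermitian `2 × 2` complex matrices. -/
abbrev Herm : Type := selfAdjoint (Matrix (Fin 2) (Fin 2) ℂ)

/-- The Minkowski metric `diag(-1, 1, 1, 1)` on `ℝ⁴`, in the coordinates `(t, x, y, z)`. -/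
def eta : Matrix (Fin 4) (Fin 4) ℝ := Matrix.diagonal ![-1, 1, 1, 1]

/-- The homogeneous Lorentz group `O(1,3)`: the matrices `Λ` with `Λᵀ η Λ = η`. It carries the
subspace topology of `GL(4, ℝ)`. -/
def lorentzGroup : Subgroup (GL (Fin 4) ℝ) where
  carrier := {g | (g : Matrix (Fin 4) (Fin 4) ℝ)ᵀ * eta * (g : Matrix (Fin 4) (Fin 4) ℝ) = eta}
  one_mem' := by simp
  mul_mem' := by
    intro a b ha hb
    simp only [Set.mem_ofPred_eq, Units.val_mul, Matrix.transpose_mul] at *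
    calc _ = (b : Matrix (Fin 4) (Fin 4) ℝ)ᵀ *
          ((a : Matrix (Fin 4) (Fin 4) ℝ)ᵀ * eta * (a : Matrix (Fin 4) (Fin 4) ℝ)) *
            (b : Matrix (Fin 4) (Fin 4) ℝ) := by simp only [Matrix.mul_assoc]
      _ = _ := by rw [ha, hb]
  inv_mem' := by
    intro a ha
    simp only [Set.mem_ofPred_eq] at *
    have h1 : (a : Matrix (Fin 4) (Fin 4) ℝ) * ((a⁻¹ : GL (Fin 4) ℝ) : Matrix (Fin 4) (Fin 4) ℝ)
        = 1 := a.mul_inv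
    have h2 : ((a⁻¹ : GL (Fin 4) ℝ) : Matrix (Fin 4) (Fin 4) ℝ)ᵀ *
        (a : Matrix (Fin 4) (Fin 4) ℝ)ᵀ = 1 := by
      rw [← Matrix.transpose_mul, h1, Matrix.transpose_one]
    calc _ = ((a⁻¹ : GL (Fin 4) ℝ) : Matrix (Fin 4) (Fin 4) ℝ)ᵀ *
          ((a : Matrix (Fin 4) (Fin 4) ℝ)ᵀ * eta * (a : Matrix (Fin 4) (Fin 4) ℝ)) *
            ((a⁻¹ : GL (Fin 4) ℝ) : Matrix (Fin 4) (Fin 4) ℝ) := by rw [ha]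
      _ = (((a⁻¹ : GL (Fin 4) ℝ) : Matrix (Fin 4) (Fin 4) ℝ)ᵀ *
          (a : Matrix (Fin 4) (Fin 4) ℝ)ᵀ) * eta * ((a : Matrix (Fin 4) (Fin 4) ℝ) *
            ((a⁻¹ : GL (Fin 4) ℝ) : Matrix (Fin 4) (Fin 4) ℝ)) := by
          simp only [Matrix.mul_assoc]
      _ = eta := by rw [h1, h2, Matrix.one_mul, Matrix.mul_one]

/-- `SO⁺(1,3)`: the identity component of the Lorentz group, as a subgroup of `GL(4, ℝ)`. -/
def SOplus : Subgroup (GL (Fin 4) ℝ) :=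
  (Subgroup.connectedComponentOfOne lorentzGroup).map lorentzGroup.subtype

/-- The identification `(t, x, y, z) ↔ !![t + z, x + i y; x - i y, t - z]` of Minkowski space `ℝ⁴`
with the Hermitian matrices. -/
def toHerm : (Fin 4 → ℝ) ≃ₗ[ℝ] Herm where
  toFun v := ⟨!![(v 0 : ℂ) + v 3, v 1 + Complex.I * v 2; v 1 - Complex.I * v 2, v 0 - v 3], by
    rw [selfAdjoint.mem_iff, Matrix.star_eq_conjTranspose]
    ext i j
    fin_cases i <;> fin_cases j <;> simp [sub_eq_add_neg]⟩
  map_add' v w := by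
    ext i j
    fin_cases i <;> fin_cases j <;> simp <;> ring
  map_smul' c v := by
    ext i j
    fin_cases i <;> fin_cases j <;> simp <;> ring
  invFun X := ![((X.1 0 0).re + (X.1 1 1).re) / 2, (X.1 0 1).re, (X.1 0 1).im,
    ((X.1 0 0).re - (X.1 1 1).re) / 2]
  left_inv v := by
    ext i
    fin_cases i <;> simp
  right_inv X := by
    have h : ∀ i j, star (X.1 j i) = X.1 i j := fun i j => by
      conv_rhs => rw [← selfAdjoint.mem_iff.1 X.2]
      rfl
    have h00 := congrArg Complex.im (h 0 0)
    have h11 := congrArg Complex.im (h 1 1)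
    have h10r := congrArg Complex.re (h 1 0)
    have h10i := congrArg Complex.im (h 1 0)
    simp at h00 h11 h10r h10i
    ext i j
    fin_cases i <;> fin_cases j <;> apply Complex.ext <;> simp <;> linarith

/-- The identification takes the determinant to minus the Minkowski square norm. -/
theorem det_toHerm (v : Fin 4 → ℝ) :
    (toHerm v : Matrix (Fin 2) (Fin 2) ℂ).det = ((-(v ⬝ᵥ (eta *ᵥ v)) : ℝ) : ℂ) := by
  simp [toHerm, eta, Matrix.det_fin_two, Matrix.mulVec_diagonal, dotProduct, Fin.sum_univ_four]
  linear_combination ((v 2 : ℂ) ^ 2) * Complex.I_sq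

/-- The linear map `P(A) : h → h`, `X ↦ A† X A`. -/
def hermAction (A : SL2C) : Herm →ₗ[ℝ] Herm where
  toFun X := ⟨A.1ᴴ * X.1 * A.1, by
    have h : (X.1)ᴴ = X.1 := selfAdjoint.mem_iff.1 X.2
    rw [selfAdjoint.mem_iff, Matrix.star_eq_conjTranspose]
    simp [Matrix.conjTranspose_mul, h, Matrix.mul_assoc]⟩
  map_add' X Y := by
    ext1
    simp [Matrix.mul_add, Matrix.add_mul]
  map_smul' c X := by
    ext1
    simp

/-- The conjugate transpose `A†` of `A ∈ SL(2, ℂ)`, again an element of `SL(2, ℂ)`. -/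
def dagger (A : SL2C) : SL2C := ⟨A.1ᴴ, by rw [Matrix.det_conjTranspose, A.2, star_one]⟩

/-- Smoothness on `s ⊆ S` of a map `f : S → T` between spaces `S`, `T` sitting in the normed spaces
`E`, `F` through `ι`, `κ`: locally around every point of `s`, the map `f` is the restriction of a
`C^∞` map from an open subset of `E` to `F`. For embedded submanifolds `S ⊆ E`, `T ⊆ F` and open `s`
this is smoothness for the submanifold structures. -/
def SmoothOn {S T E F : Type*} [NormedAddCommGroup E] [NormedSpace ℝ E] [NormedAddCommGroup F]
    [NormedSpace ℝ F] (ι : S → E) (κ : T → F) (f : S → T) (s : Set S) : Prop :=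
  ∀ x ∈ s, ∃ U : Set E, IsOpen U ∧ ι x ∈ U ∧ ∃ G : E → F, ContDiffOn ℝ ∞ G U ∧
    ∀ y ∈ s, ι y ∈ U → κ (f y) = G (ι y)

/-- The embedding of `SL(2, ℂ)` in the real vector space of `2 × 2` complex matrices. -/
def slEntries (A : SL2C) : Fin 2 → Fin 2 → ℂ := fun i j => A.1 i j

/-- The embedding of `SO⁺(1,3)` in the real vector space of `4 × 4` real matrices. -/
def soEntries (Λ : SOplus) : Fin 4 → Fin 4 → ℝ :=
  fun i j => ((Λ : GL (Fin 4) ℝ) : Matrix (Fin 4) (Fin 4) ℝ) i j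

/-- `p : SL(2, ℂ) → SO⁺(1,3)` is a smooth map. -/
def IsSmooth (p : SL2C → SOplus) : Prop := SmoothOn slEntries soEntries p Set.univ

/-- `p : SL(2, ℂ) → SO⁺(1,3)` is a local diffeomorphism: around every point it restricts to a
homeomorphism between open sets which is smooth with smooth inverse. -/
def IsLocalDiffeo (p : SL2C → SOplus) : Prop :=
  ∀ A, ∃ e : OpenPartialHomeomorph SL2C SOplus, A ∈ e.source ∧ Set.EqOn p e e.source ∧
    SmoothOn slEntries soEntries e e.source ∧ SmoothOn soEntries slEntries e.symm e.target

/-- `p : SL(2, ℂ) → SO⁺(1,3)` is a universal cover of `SO⁺(1,3)`, in the smooth sense: a surjective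
covering map that is a local diffeomorphism, with simply connected total space. -/
structure IsUniversalCover (p : SL2C → SOplus) : Prop where
  simplyConnected : SimplyConnectedSpace SL2C
  surjective : Function.Surjective p
  isCoveringMap : IsCoveringMap p
  isLocalDiffeo : IsLocalDiffeo p

end SpinCover

end

open scoped unitInterval
open Set Filter Topology

/-! Everything is proved for the homomorphism `spinHom`, the action X ↦ A X A†, and then carried to
p = `spinHom` ∘ † by the smooth anti-automorphism †, which is an involution.

Simple connectedness: projecting SL(2, ℂ) to the first column has affine lines as fibres and admits
a section, so SL(2, ℂ) is homotopy equivalent to ℂ² ∖ {0}. In that space, of real dimension 4, a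
loop is homotopic to a C¹ loop, which misses some line through the origin and can be contracted to a
point off the origin.

The action preserves determinants, hence the Minkowski form, and lands in the identity component
because SL(2, ℂ) is connected. Surjectivity needs only that det Λ and Λ₀₀ are positive on that
component: correcting Λ by elements of the image makes it fix e₀, then e₃, and what remains is a
rotation about the z axis, which is the image of a diagonal matrix (`exists_lorentzMatrix_eq`).

The local inverse is explicit. The sum ½ ∑ Λ(e_μ) σ_μ equals conj(tr A) • A
(`twistedTrace_spinHom`), with determinant conj(tr A)², so Λ determines A up to the sign of a square
root whenever tr A ≠ 0. Hence the kernel is ±1, and the principal root gives a smooth inverse where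
Re tr A > 0. Left translation spreads this chart over the group, and discreteness of the kernel
yields the covering property. -/

/-! ### Simple connectedness of a punctured space of dimension at least 3 -/

/-- Every loop in a finite-dimensional normed space is a uniform limit of smooth loops with the
same base point. -/
theorem Path.exists_contDiff_approx {E : Type*} [NormedAddCommGroup E] [NormedSpace ℝ E] {x : E}
    (p : Path x x) {ε : ℝ} (hε : 0 < ε) :
    ∃ q : ℝ → E, ContDiff ℝ 1 q ∧ q 0 = x ∧ q 1 = x ∧ ∀ t : I, ‖q t - p t‖ < ε := by
  have h := bernsteinApproximation_uniform (p : C(I, E))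
  rw [Metric.tendsto_atTop] at h
  obtain ⟨N, hN⟩ := h ε hε
  -- A positive degree is needed for the Bernstein approximation to interpolate at the endpoint 1.
  specialize hN (N + 1) (Nat.le_succ N)
  let q : ℝ → E := fun t => ∑ k : Fin (N + 1 + 1),
    (bernsteinPolynomial ℝ (N + 1) k).eval t • p (bernstein.z k)
  have hq : ∀ t : I, q t = bernsteinApproximation (N + 1) (p : C(I, E)) t := fun t => by
    rw [bernsteinApproximation.apply]
    rfl
  refine ⟨q, ?_, ?_, ?_, fun t => ?_⟩
  · refine ContDiff.sum fun k _ => ContDiff.smul ?_ contDiff_const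
    simpa using Polynomial.contDiff_aeval (𝕜 := ℝ) (bernsteinPolynomial ℝ (N + 1) k) 1
  · simpa using hq 0
  · simpa [bernsteinApproximation.apply_one (Nat.succ_ne_zero N)] using hq 1
  · rw [hq, ← dist_eq_norm]
    exact (ContinuousMap.dist_lt_iff hε).1 hN t

/-- A smooth curve avoiding the origin of a space of dimension at least `3` also avoids some line
through the origin. -/
theorem ContDiff.exists_forall_smul_ne {E : Type*} [NormedAddCommGroup E] [NormedSpace ℝ E]
    [FiniteDimensional ℝ E] (hE : 2 < Module.finrank ℝ E) {q : ℝ → E} (hq : ContDiff ℝ 1 q) :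
    ∃ v : E, ∀ s t : ℝ, s • q t ≠ v := by
  have h : ContDiff ℝ 1 fun z : ℝ × ℝ => z.1 • q z.2 :=
    contDiff_fst.smul (hq.comp contDiff_snd)
  have hd := h.dense_compl_range_of_finrank_lt_finrank (by simpa using hE)
  obtain ⟨v, hv⟩ := hd.nonempty
  exact ⟨v, fun s t hst => hv ⟨(s, t), hst⟩⟩

/-- The points seen from `v` without obstruction by the origin form a star-shaped set. -/
theorem starConvex_zero_notMem_segment {E : Type*} [AddCommGroup E] [Module ℝ E] (v : E) :
    StarConvex ℝ v {w : E | (0 : E) ∉ segment ℝ v w} := by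
  rw [starConvex_iff_segment_subset]
  intro w hw y hy h0
  exact hw ((convex_segment v w).segment_subset (left_mem_segment ℝ v w) hy h0)

/-- The complement of the origin in a real vector space of finite dimension at least `3` is simply
connected. -/
theorem isSimplyConnected_compl_zero {E : Type*} [NormedAddCommGroup E] [NormedSpace ℝ E]
    [FiniteDimensional ℝ E] (hE : 2 < Module.finrank ℝ E) : IsSimplyConnected ({0}ᶜ : Set E) := by
  rw [isSimplyConnected_iff_exists_homotopy_refl_forall_mem]
  refine ⟨isPathConnected_compl_singleton_of_one_lt_rank ?_ 0, fun x p hp => ?_⟩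
  · rw [← Module.finrank_eq_rank]
    exact_mod_cast (by omega : 1 < Module.finrank ℝ E)
  obtain ⟨t₀, -, ht₀⟩ := isCompact_univ.exists_isMinOn (s := (univ : Set I)) ⟨0, mem_univ _⟩
    (f := fun t => ‖p t‖) (by fun_prop)
  have hmin : ∀ t, ‖p t₀‖ ≤ ‖p t‖ := fun t => ht₀ (mem_univ t)
  -- The tolerance is the distance from the loop to the origin, so that the straight-line homotopy
  -- from `p` to `q` never meets 0.
  obtain ⟨q, hq, hq0, hq1, hqp⟩ := p.exists_contDiff_approx (norm_pos_iff.2 (hp t₀))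
  obtain ⟨v, hv⟩ := hq.exists_forall_smul_ne hE
  have hne : ∀ (s t : I), (1 - (s : ℝ)) • p t + (s : ℝ) • q t ≠ 0 := fun s t h0 => by
    have h1 : p t = -((s : ℝ) • (q t - p t)) := by
      rw [← sub_eq_zero, ← h0]
      module
    have h2 : ‖p t‖ ≤ ‖q t - p t‖ := by
      conv_lhs => rw [h1, norm_neg, norm_smul, Real.norm_of_nonneg s.2.1]
      exact mul_le_of_le_one_left (norm_nonneg _) s.2.2
    exact absurd (hqp t) (not_lt.2 ((hmin t).trans h2))
  let q' : Path x x :=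
    { toFun := fun t => q t
      continuous_toFun := hq.continuous.comp continuous_subtype_val
      source' := by simpa using hq0
      target' := by simpa using hq1 }
  let F : p.Homotopy q' :=
    { toFun := fun z => (1 - (z.1 : ℝ)) • p z.2 + (z.1 : ℝ) • q z.2
      continuous_toFun := by
        have := hq.continuous
        fun_prop
      map_zero_left := fun t => by simp
      map_one_left := fun t => by simp [q']
      prop' := by
        rintro s t (rfl | rfl)
        · simp [hq0, ← add_smul]
        · simp [hq1, ← add_smul] }
  -- The star-shaped set of points visible from `v` is contractible and omits 0. It contains `q`: if
  -- 0 lay between `v` and `q t`, then `v` would be a multiple of `q t`, against the choice of `v`.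
  have hS := starConvex_zero_notMem_segment v
  have hqS : ∀ t : I, (0 : E) ∉ segment ℝ v (q t) := by
    rintro t ⟨a, b, ha, hb, hab, h0⟩
    have hqt : q t ≠ 0 := by simpa using hne 1 t
    rcases ha.eq_or_lt with rfl | ha
    · rw [zero_add] at hab
      simp [hab, hqt] at h0
    · refine hv (-(b / a)) t ?_
      have h1 : a • v = -(b • q t) := eq_neg_of_add_eq_zero_left h0
      rw [neg_smul, div_eq_inv_mul, mul_smul, ← smul_neg, ← h1, smul_smul,
        inv_mul_cancel₀ ha.ne', one_smul]
  have hxS : x ∈ {w : E | (0 : E) ∉ segment ℝ v w} := by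
    simpa [hq0] using hqS 0
  have := hS.contractibleSpace ⟨x, hxS⟩
  have hsc : IsSimplyConnected {w : E | (0 : E) ∉ segment ℝ v w} :=
    SimplyConnectedSpace.ofContractible _
  obtain ⟨G, hG⟩ := (isSimplyConnected_iff_exists_homotopy_refl_forall_mem.1 hsc).2 x q' hqS
  refine ⟨F.trans G, fun z => ?_⟩
  rw [Path.Homotopy.trans_apply]
  split_ifs with hz
  · exact hne _ _
  · intro h0
    exact hG _ (by rw [mem_singleton_iff.1 h0]; exact right_mem_segment ℝ v 0)

namespace SpinCover

/-! ### The homotopy type of SL(2, ℂ) -/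

/-- The first column of a matrix in `SL(2, ℂ)`, a nonzero vector. -/
def firstColumn : C(SL2C, ({0}ᶜ : Set (ℂ × ℂ))) where
  toFun A := ⟨(A.1 0 0, A.1 1 0), fun h => by
    have h' := A.2
    rw [mem_singleton_iff, Prod.mk_eq_zero] at h
    rw [Matrix.det_fin_two, h.1, h.2] at h'
    simp at h'⟩
  continuous_toFun := by
    refine Continuous.subtype_mk (Continuous.prodMk ?_ ?_) _ <;>
      exact (continuous_subtype_val : Continuous fun A : SL2C => A.1).matrix_elem _ _

theorem mul_conj_add_mul_conj_ne_zero {v : ℂ × ℂ} (hv : v ≠ 0) :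
    v.1 * star v.1 + v.2 * star v.2 ≠ 0 := by
  intro h
  have h' := congrArg Complex.re h
  simp [Complex.mul_conj] at h'
  refine hv (Prod.ext ?_ ?_)
  · exact Complex.normSq_eq_zero.1
      (by linarith [Complex.normSq_nonneg v.1, Complex.normSq_nonneg v.2])
  · exact Complex.normSq_eq_zero.1
      (by linarith [Complex.normSq_nonneg v.1, Complex.normSq_nonneg v.2])

/-- A matrix in `SL(2, ℂ)` with given nonzero first column and orthogonal second column. -/
noncomputable def ofFirstColumn : C(({0}ᶜ : Set (ℂ × ℂ)), SL2C) where
  toFun v := ⟨!![v.1.1, -(star v.1.2 / (v.1.1 * star v.1.1 + v.1.2 * star v.1.2));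
      v.1.2, star v.1.1 / (v.1.1 * star v.1.1 + v.1.2 * star v.1.2)], by
    have := mul_conj_add_mul_conj_ne_zero v.2
    rw [Matrix.det_fin_two_of]
    field_simp
    ring⟩
  continuous_toFun := by
    refine Continuous.subtype_mk (continuous_matrix fun i j => ?_) _
    have := fun v : ({0}ᶜ : Set (ℂ × ℂ)) => mul_conj_add_mul_conj_ne_zero v.2
    fin_cases i <;> fin_cases j <;> simp <;> fun_prop (disch := exact this)

/-- `SL(2, ℂ)` is homotopy equivalent to `ℂ² ∖ {0}`. -/
noncomputable def homotopyEquivComplZero : ContinuousMap.HomotopyEquiv SL2C ({0}ᶜ : Set (ℂ × ℂ)) where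
  toFun := firstColumn
  invFun := ofFirstColumn
  left_inv := ⟨
    -- With the first column fixed, the determinant is affine in the second column, so the segment
    -- between two admissible second columns stays in SL(2, ℂ).
    { toFun := fun z => ⟨!![z.2.1 0 0, (1 - (z.1 : ℂ)) * (ofFirstColumn (firstColumn z.2)).1 0 1 +
            (z.1 : ℂ) * z.2.1 0 1;
          z.2.1 1 0, (1 - (z.1 : ℂ)) * (ofFirstColumn (firstColumn z.2)).1 1 1 +
            (z.1 : ℂ) * z.2.1 1 1], by
        have h1 := z.2.2
        have h2 := (ofFirstColumn (firstColumn z.2)).2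
        rw [Matrix.det_fin_two] at h1 h2
        have e1 : (ofFirstColumn (firstColumn z.2)).1 0 0 = z.2.1 0 0 := rfl
        have e2 : (ofFirstColumn (firstColumn z.2)).1 1 0 = z.2.1 1 0 := rfl
        rw [e1, e2] at h2
        rw [Matrix.det_fin_two_of]
        linear_combination (z.1 : ℂ) * h1 + (1 - (z.1 : ℂ)) * h2⟩
      continuous_toFun := by
        have h1 : ∀ i j, Continuous fun A : SL2C => A.1 i j := fun i j =>
          (continuous_subtype_val : Continuous fun A : SL2C => A.1).matrix_elem i j
        have h2 : ∀ i j, Continuous fun A : SL2C => (ofFirstColumn (firstColumn A)).1 i j :=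
          fun i j => (h1 i j).comp (ofFirstColumn.continuous.comp firstColumn.continuous)
        have h3 : ∀ i j, Continuous fun z : I × SL2C => z.2.1 i j := fun i j =>
          (h1 i j).comp continuous_snd
        have h4 : ∀ i j, Continuous fun z : I × SL2C =>
          (ofFirstColumn (firstColumn z.2)).1 i j := fun i j => (h2 i j).comp continuous_snd
        have h5 : Continuous fun z : I × SL2C => ((z.1 : ℝ) : ℂ) := by fun_prop
        refine Continuous.subtype_mk (continuous_matrix fun i j => ?_) _
        fin_cases i <;> fin_cases j
        · exact h3 0 0
        · exact ((continuous_const.sub h5).mul (h4 0 1)).add (h5.mul (h3 0 1))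
        · exact h3 1 0
        · exact ((continuous_const.sub h5).mul (h4 1 1)).add (h5.mul (h3 1 1))
      map_zero_left := fun A => by
        apply Subtype.ext
        ext i j
        fin_cases i <;> fin_cases j <;> simp <;> rfl
      map_one_left := fun A => by
        apply Subtype.ext
        ext i j
        fin_cases i <;> fin_cases j <;> simp }⟩
  right_inv := by
    have : firstColumn.comp ofFirstColumn = ContinuousMap.id _ := by
      ext v <;> rfl
    rw [this]

theorem simplyConnectedSpace_SL2C : SimplyConnectedSpace SL2C :=
  have : SimplyConnectedSpace ({0}ᶜ : Set (ℂ × ℂ)) :=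
    isSimplyConnected_compl_zero (by simp [Module.finrank_prod, Complex.finrank_real_complex])
  homotopyEquivComplZero.simplyConnectedSpace

/-! ### The action on Minkowski space and the spin homomorphism -/

@[simp]
theorem coe_hermAction_dagger (A : SL2C) (X : Herm) :
    (hermAction (dagger A) X : Matrix (Fin 2) (Fin 2) ℂ) = A.1 * X.1 * A.1ᴴ := by
  change A.1ᴴᴴ * X.1 * A.1ᴴ = _
  rw [Matrix.conjTranspose_conjTranspose]

@[simp]
theorem dagger_dagger (A : SL2C) : dagger (dagger A) = A :=
  Subtype.ext (Matrix.conjTranspose_conjTranspose A.1)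

theorem dagger_mul (A B : SL2C) : dagger (A * B) = dagger B * dagger A :=
  Subtype.ext (Matrix.conjTranspose_mul A.1 B.1)

theorem dagger_one : dagger 1 = 1 :=
  Subtype.ext Matrix.conjTranspose_one

theorem dagger_neg_one : dagger (-1) = -1 := by
  apply Subtype.ext
  change (-1 : Matrix (Fin 2) (Fin 2) ℂ)ᴴ = -1
  simp

theorem matrix_eq_of_toHerm_mulVec_eq {M N : Matrix (Fin 4) (Fin 4) ℝ}
    (h : ∀ v, toHerm (M *ᵥ v) = toHerm (N *ᵥ v)) : M = N :=
  Matrix.mulVec_injective (funext fun v => toHerm.injective (h v))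

/-- The matrix of the action `X ↦ A X A†` on Minkowski space. -/
noncomputable def lorentzMatrix : SL2C →* Matrix (Fin 4) (Fin 4) ℝ where
  toFun A := LinearMap.toMatrix' (toHerm.symm.toLinearMap ∘ₗ hermAction (dagger A) ∘ₗ
    toHerm.toLinearMap)
  map_one' := matrix_eq_of_toHerm_mulVec_eq fun v => by
    rw [LinearMap.toMatrix'_mulVec]
    apply Subtype.ext
    simp
  map_mul' A B := matrix_eq_of_toHerm_mulVec_eq fun v => by
    rw [← Matrix.mulVec_mulVec, LinearMap.toMatrix'_mulVec, LinearMap.toMatrix'_mulVec,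
      LinearMap.toMatrix'_mulVec]
    apply Subtype.ext
    simp [Matrix.mul_assoc]

theorem toHerm_lorentzMatrix_mulVec (A : SL2C) (v : Fin 4 → ℝ) :
    toHerm (lorentzMatrix A *ᵥ v) = hermAction (dagger A) (toHerm v) := by
  change toHerm (LinearMap.toMatrix' _ *ᵥ v) = _
  rw [LinearMap.toMatrix'_mulVec]
  simp

theorem coe_toHerm_lorentzMatrix_mulVec (A : SL2C) (v : Fin 4 → ℝ) :
    (toHerm (lorentzMatrix A *ᵥ v) : Matrix (Fin 2) (Fin 2) ℂ) =
      A.1 * (toHerm v).1 * A.1ᴴ := by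
  rw [toHerm_lorentzMatrix_mulVec, coe_hermAction_dagger]

theorem lorentzMatrix_mulVec_eq_iff (A : SL2C) (v w : Fin 4 → ℝ) :
    lorentzMatrix A *ᵥ v = w ↔ A.1 * (toHerm v).1 * A.1ᴴ = (toHerm w).1 := by
  rw [← coe_toHerm_lorentzMatrix_mulVec, Subtype.coe_inj, toHerm.injective.eq_iff]

theorem quadratic_eta_lorentzMatrix (A : SL2C) (v : Fin 4 → ℝ) :
    (lorentzMatrix A *ᵥ v) ⬝ᵥ (eta *ᵥ (lorentzMatrix A *ᵥ v)) = v ⬝ᵥ (eta *ᵥ v) := by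
  have h := det_toHerm (lorentzMatrix A *ᵥ v)
  rw [coe_toHerm_lorentzMatrix_mulVec, Matrix.det_mul, Matrix.det_mul,
    Matrix.det_conjTranspose, A.2, det_toHerm, star_one, one_mul, mul_one,
    Complex.ofReal_inj] at h
  exact (neg_inj.1 h).symm

/-- Polarization: the values at e_i, e_j and e_i + e_j determine the (i, j) entry. -/
theorem isSymm_ext_of_quadratic_eq {n : Type*} [Fintype n] [DecidableEq n] {M N : Matrix n n ℝ}
    (hM : M.IsSymm) (hN : N.IsSymm) (h : ∀ v, v ⬝ᵥ (M *ᵥ v) = v ⬝ᵥ (N *ᵥ v)) : M = N := by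
  ext i j
  have hi := h (Pi.single i 1)
  have hj := h (Pi.single j 1)
  have hij := h (Pi.single i 1 + Pi.single j 1)
  have e1 := hM.apply i j
  have e2 := hN.apply i j
  simp [Matrix.mulVec_add] at hi hj hij
  linarith

theorem isSymm_eta : eta.IsSymm := Matrix.isSymm_diagonal _

theorem lorentzMatrix_transpose_mul_eta_mul (A : SL2C) :
    (lorentzMatrix A)ᵀ * eta * lorentzMatrix A = eta := by
  refine isSymm_ext_of_quadratic_eq ?_ isSymm_eta fun v => ?_
  · rw [Matrix.IsSymm, Matrix.transpose_mul, Matrix.transpose_mul, Matrix.transpose_transpose,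
      isSymm_eta.eq, Matrix.mul_assoc]
  · rw [← quadratic_eta_lorentzMatrix A v, ← Matrix.mulVec_mulVec, ← Matrix.mulVec_mulVec,
      Matrix.dotProduct_mulVec, Matrix.vecMul_transpose]

/-- The action `X ↦ A X A†` as a homomorphism to the Lorentz group. -/
noncomputable def toLorentz : SL2C →* lorentzGroup :=
  lorentzMatrix.toHomUnits.codRestrict lorentzGroup lorentzMatrix_transpose_mul_eta_mul

theorem coe_toLorentz (A : SL2C) :
    ((toLorentz A : GL (Fin 4) ℝ) : Matrix (Fin 4) (Fin 4) ℝ) = lorentzMatrix A := rfl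

/-- The four coordinates of a Hermitian matrix, as a real-linear map on all matrices. -/
noncomputable def hermCoord (X : Matrix (Fin 2) (Fin 2) ℂ) : Fin 4 → ℝ :=
  ![((X 0 0).re + (X 1 1).re) / 2, (X 0 1).re, (X 0 1).im, ((X 0 0).re - (X 1 1).re) / 2]

/-- The right-hand side makes sense for every complex matrix in place of `A`. This gives the smooth
extension to the ambient space required by `IsSmooth`. -/
theorem lorentzMatrix_apply (A : SL2C) (i j : Fin 4) :
    lorentzMatrix A i j = hermCoord (A.1 * (toHerm (Pi.single j 1)).1 * A.1ᴴ) i := by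
  have h : lorentzMatrix A i j = (lorentzMatrix A *ᵥ Pi.single j 1) i := by simp
  rw [h, ← coe_toHerm_lorentzMatrix_mulVec]
  exact congrFun (toHerm.symm_apply_apply _).symm i

theorem contDiff_hermCoord_conj (H : Matrix (Fin 2) (Fin 2) ℂ) (i : Fin 4) :
    ContDiff ℝ ∞ fun M : Fin 2 → Fin 2 → ℂ =>
      hermCoord (Matrix.of M * H * (Matrix.of M)ᴴ) i := by
  have hc : ∀ a b, ContDiff ℝ ∞ fun M : Fin 2 → Fin 2 → ℂ =>
      (Matrix.of M * H * (Matrix.of M)ᴴ) a b := fun a b => by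
    simp only [Matrix.mul_apply, Fin.sum_univ_two, Matrix.conjTranspose_apply, Matrix.of_apply]
    have hs : ∀ a b, ContDiff ℝ ∞ fun M : Fin 2 → Fin 2 → ℂ => star (M a b) := fun a b =>
      (starL' ℝ : ℂ ≃L[ℝ] ℂ).contDiff.comp (contDiff_apply_apply ℝ ℂ a b)
    have hm : ∀ a b, ContDiff ℝ ∞ fun M : Fin 2 → Fin 2 → ℂ => M a b := fun a b =>
      contDiff_apply_apply ℝ ℂ a b
    fun_prop
  have hre : ∀ a b, ContDiff ℝ ∞ fun M : Fin 2 → Fin 2 → ℂ =>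
      ((Matrix.of M * H * (Matrix.of M)ᴴ) a b).re := fun a b => Complex.reCLM.contDiff.comp (hc a b)
  have him : ∀ a b, ContDiff ℝ ∞ fun M : Fin 2 → Fin 2 → ℂ =>
      ((Matrix.of M * H * (Matrix.of M)ᴴ) a b).im := fun a b => Complex.imCLM.contDiff.comp (hc a b)
  fin_cases i
  · exact ((hre 0 0).add (hre 1 1)).div_const 2
  · exact hre 0 1
  · exact him 0 1
  · exact ((hre 0 0).sub (hre 1 1)).div_const 2

theorem continuous_slEntries : Continuous slEntries :=
  continuous_pi fun i => continuous_pi fun j =>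
    (continuous_subtype_val : Continuous fun A : SL2C => A.1).matrix_elem i j

theorem continuous_lorentzMatrix : Continuous lorentzMatrix := by
  refine continuous_matrix fun i j => ?_
  simp only [lorentzMatrix_apply]
  exact (contDiff_hermCoord_conj _ i).continuous.comp continuous_slEntries

theorem continuous_toLorentz : Continuous toLorentz := by
  have h : ∀ A, lorentzMatrix A⁻¹ =
      ((lorentzMatrix.toHomUnits A)⁻¹ : GL (Fin 4) ℝ) := fun A => by
    rw [← map_inv]
    rfl
  have hu : Continuous lorentzMatrix.toHomUnits :=
    Units.continuous_iff.2 ⟨continuous_lorentzMatrix,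
      (continuous_lorentzMatrix.comp continuous_inv).congr h⟩
  exact hu.subtype_mk _

theorem toLorentz_mem_connectedComponentOfOne (A : SL2C) :
    toLorentz A ∈ Subgroup.connectedComponentOfOne lorentzGroup := by
  have := simplyConnectedSpace_SL2C
  exact (isPreconnected_range continuous_toLorentz).subset_connectedComponent
    ⟨1, map_one _⟩ ⟨A, rfl⟩

/-- The spin homomorphism `SL(2, ℂ) → SO⁺(1,3)`, given by the action `X ↦ A X A†`. -/
noncomputable def spinHom : SL2C →* SOplus :=
  (lorentzGroup.subtype.comp toLorentz).codRestrict SOplus fun A =>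
    ⟨toLorentz A, toLorentz_mem_connectedComponentOfOne A, rfl⟩

theorem coe_spinHom (A : SL2C) :
    ((spinHom A : GL (Fin 4) ℝ) : Matrix (Fin 4) (Fin 4) ℝ) = lorentzMatrix A := rfl

theorem continuous_spinHom : Continuous spinHom :=
  (continuous_subtype_val.comp continuous_toLorentz).subtype_mk _

theorem isSmooth_spinHom : IsSmooth spinHom := fun _ _ =>
  ⟨univ, isOpen_univ, mem_univ _,
    fun M i j => hermCoord (Matrix.of M * (toHerm (Pi.single j 1)).1 * (Matrix.of M)ᴴ) i,
    (contDiff_pi.2 fun i => contDiff_pi.2 fun _ => contDiff_hermCoord_conj _ i).contDiffOn,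
    fun A _ _ => funext fun i => funext fun j => lorentzMatrix_apply A i j⟩

/-! ### Surjectivity onto the identity component -/

theorem coe_toHerm (v : Fin 4 → ℝ) : (toHerm v : Matrix (Fin 2) (Fin 2) ℂ) =
    !![(v 0 : ℂ) + v 3, v 1 + Complex.I * v 2; v 1 - Complex.I * v 2, v 0 - v 3] := rfl

theorem lorentz_col_mul_col {M : Matrix (Fin 4) (Fin 4) ℝ} (h : Mᵀ * eta * M = eta)
    (i j : Fin 4) :
    -(M 0 i * M 0 j) + M 1 i * M 1 j + M 2 i * M 2 j + M 3 i * M 3 j = eta i j := by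
  have h' := congrFun (congrFun h i) j
  rw [← h']
  simp [eta, Matrix.mul_apply, Fin.sum_univ_four]

theorem lorentz_det_ne_zero {M : Matrix (Fin 4) (Fin 4) ℝ} (h : Mᵀ * eta * M = eta) :
    M.det ≠ 0 := by
  intro h0
  have h' := congrArg Matrix.det h
  rw [Matrix.det_mul, h0, mul_zero, eta, Matrix.det_diagonal] at h'
  simp [Fin.prod_univ_four] at h'

theorem lorentz_zero_zero_ne_zero {M : Matrix (Fin 4) (Fin 4) ℝ} (h : Mᵀ * eta * M = eta) :
    M 0 0 ≠ 0 := by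
  intro h0
  have h' := lorentz_col_mul_col h 0 0
  simp [eta, h0] at h'
  nlinarith [mul_self_nonneg (M 1 0), mul_self_nonneg (M 2 0), mul_self_nonneg (M 3 0)]

/-- By the intermediate value theorem, a nowhere vanishing continuous function keeps its sign on a
connected component. It is applied to the determinant and to the time-time entry. -/
theorem pos_of_mem_connectedComponentOfOne {G : Type*} [TopologicalSpace G] [Group G]
    [IsTopologicalGroup G] {f : G → ℝ} (hf : Continuous f) (h0 : ∀ g, f g ≠ 0) (h1 : 0 < f 1)
    {g : G} (hg : g ∈ Subgroup.connectedComponentOfOne G) : 0 < f g := by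
  by_contra hneg
  have hpre : IsPreconnected (connectedComponent (1 : G)) := isPreconnected_connectedComponent
  obtain ⟨x, -, hx⟩ := hpre.intermediate_value (show g ∈ connectedComponent (1 : G) from hg)
    mem_connectedComponent hf.continuousOn ⟨not_lt.1 hneg, h1.le⟩
  exact h0 x hx

theorem continuous_lorentzGroup_val :
    Continuous fun g : lorentzGroup => ((g : GL (Fin 4) ℝ) : Matrix (Fin 4) (Fin 4) ℝ) :=
  Units.continuous_val.comp continuous_subtype_val

theorem det_pos_of_mem_connectedComponentOfOne {g : lorentzGroup}
    (hg : g ∈ Subgroup.connectedComponentOfOne lorentzGroup) :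
    0 < ((g : GL (Fin 4) ℝ) : Matrix (Fin 4) (Fin 4) ℝ).det :=
  pos_of_mem_connectedComponentOfOne
    (f := fun g : lorentzGroup => ((g : GL (Fin 4) ℝ) : Matrix (Fin 4) (Fin 4) ℝ).det)
    continuous_lorentzGroup_val.matrix_det (fun g => lorentz_det_ne_zero g.2) (by simp) hg

theorem zero_zero_pos_of_mem_connectedComponentOfOne {g : lorentzGroup}
    (hg : g ∈ Subgroup.connectedComponentOfOne lorentzGroup) :
    0 < ((g : GL (Fin 4) ℝ) : Matrix (Fin 4) (Fin 4) ℝ) 0 0 :=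
  pos_of_mem_connectedComponentOfOne
    (f := fun g : lorentzGroup => ((g : GL (Fin 4) ℝ) : Matrix (Fin 4) (Fin 4) ℝ) 0 0)
    (continuous_lorentzGroup_val.matrix_elem 0 0) (fun g => lorentz_zero_zero_ne_zero g.2)
    (by simp) hg

theorem det_lorentzMatrix_pos (A : SL2C) : 0 < (lorentzMatrix A).det := by
  have h := det_pos_of_mem_connectedComponentOfOne (toLorentz_mem_connectedComponentOfOne A)
  rwa [coe_toLorentz] at h

theorem lorentzMatrix_mul_inv (A : SL2C) : lorentzMatrix A * lorentzMatrix A⁻¹ = 1 := by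
  rw [← map_mul, mul_inv_cancel, map_one]

theorem lorentzMatrix_inv_mul (A : SL2C) : lorentzMatrix A⁻¹ * lorentzMatrix A = 1 := by
  rw [← map_mul, inv_mul_cancel, map_one]

theorem lorentzMatrix_inv_mulVec_eq {A : SL2C} {v w : Fin 4 → ℝ}
    (h : lorentzMatrix A *ᵥ v = w) : lorentzMatrix A⁻¹ *ᵥ w = v := by
  rw [← h, Matrix.mulVec_mulVec, lorentzMatrix_inv_mul, Matrix.one_mulVec]

theorem lorentzMatrix_mul_transpose_mul_eta_mul (A : SL2C) {M : Matrix (Fin 4) (Fin 4) ℝ}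
    (h : Mᵀ * eta * M = eta) :
    (lorentzMatrix A * M)ᵀ * eta * (lorentzMatrix A * M) = eta := by
  calc (lorentzMatrix A * M)ᵀ * eta * (lorentzMatrix A * M)
      = Mᵀ * ((lorentzMatrix A)ᵀ * eta * lorentzMatrix A) * M := by
        simp only [Matrix.transpose_mul, Matrix.mul_assoc]
    _ = eta := by rw [lorentzMatrix_transpose_mul_eta_mul, h]

theorem exists_lorentzMatrix_eq_of_inv_mul {A : SL2C} {M : Matrix (Fin 4) (Fin 4) ℝ}
    (h : ∃ B, lorentzMatrix B = lorentzMatrix A⁻¹ * M) : ∃ B, lorentzMatrix B = M := by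
  obtain ⟨B, hB⟩ := h
  exact ⟨A * B, by rw [map_mul, hB, ← Matrix.mul_assoc, lorentzMatrix_mul_inv, Matrix.one_mul]⟩

/-- A rotation about the `z` axis comes from a diagonal matrix. -/
theorem exists_lorentzMatrix_eq_of_fix_zero_three {M : Matrix (Fin 4) (Fin 4) ℝ}
    (h : Mᵀ * eta * M = eta) (hdet : 0 < M.det) (h0 : M *ᵥ Pi.single 0 1 = Pi.single 0 1)
    (h3 : M *ᵥ Pi.single 3 1 = Pi.single 3 1) : ∃ A, lorentzMatrix A = M := by
  have c0 : ∀ i, M i 0 = (Pi.single 0 1 : Fin 4 → ℝ) i := fun i => by simpa using congrFun h0 i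
  have c3 : ∀ i, M i 3 = (Pi.single 3 1 : Fin 4 → ℝ) i := fun i => by simpa using congrFun h3 i
  have c00 := c0 0
  have c10 := c0 1
  have c20 := c0 2
  have c30 := c0 3
  have c03 := c3 0
  have c13 := c3 1
  have c23 := c3 2
  have c33 := c3 3
  simp at c00 c10 c20 c30 c03 c13 c23 c33
  have r01 := lorentz_col_mul_col h 0 1
  have r02 := lorentz_col_mul_col h 0 2
  have r31 := lorentz_col_mul_col h 3 1
  have r32 := lorentz_col_mul_col h 3 2
  have r11 := lorentz_col_mul_col h 1 1
  have r22 := lorentz_col_mul_col h 2 2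
  have r12 := lorentz_col_mul_col h 1 2
  simp [eta, c00, c10, c20, c30, c03, c13, c23, c33] at r01 r02 r31 r32
  simp [eta, r01, r02, r31, r32] at r11 r22 r12
  have hd : M.det = M 1 1 * M 2 2 - M 1 2 * M 2 1 := by
    rw [Matrix.det_succ_column_zero]
    simp [Fin.sum_univ_four, c00, c10, c20, c30, Matrix.det_fin_three, Fin.succAbove]
    simp [c33, c13, c23]
  rw [hd] at hdet
  -- Lagrange's identity for two orthonormal columns gives square 1, and positivity of the
  -- determinant selects the root 1.
  have hd1 : M 1 1 * M 2 2 - M 1 2 * M 2 1 = 1 := by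
    have : (M 1 1 * M 2 2 - M 1 2 * M 2 1) ^ 2 = 1 := by
      linear_combination (M 1 2 * M 1 2 + M 2 2 * M 2 2) * r11 + r22 -
        (M 1 1 * M 1 2 + M 2 1 * M 2 2) * r12
    exact (pow_eq_one_iff_of_nonneg hdet.le two_ne_zero).1 this
  have hs : (M 1 1 - M 2 2) ^ 2 + (M 1 2 + M 2 1) ^ 2 = 0 := by
    linear_combination r11 + r22 - 2 * hd1
  obtain ⟨hs1, hs2⟩ := (add_eq_zero_iff_of_nonneg (sq_nonneg _) (sq_nonneg _)).1 hs
  have e22 : M 2 2 = M 1 1 := (sub_eq_zero.1 (pow_eq_zero_iff two_ne_zero |>.1 hs1)).symm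
  have e12 : M 1 2 = -M 2 1 := eq_neg_of_add_eq_zero_left (pow_eq_zero_iff two_ne_zero |>.1 hs2)
  -- Conjugation by diag(u, ū) multiplies the off-diagonal entry x + iy by u², so `u` is a square
  -- root of the rotation's unit complex number (the half angle).
  obtain ⟨u, hu⟩ := IsAlgClosed.exists_pow_nat_eq (M 1 1 + Complex.I * M 2 1 : ℂ) two_pos
  have hc : star u ^ 2 = M 1 1 - Complex.I * M 2 1 := by
    rw [← star_pow, hu]
    simp [sub_eq_add_neg]
  have hn : u * star u = 1 := by
    have h2 : (u * star u) ^ 2 = 1 := by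
      rw [mul_pow, hu, hc]
      have := congrArg (fun x : ℝ => (x : ℂ)) r11
      push_cast at this
      linear_combination this - (M 2 1 : ℂ) ^ 2 * Complex.I_sq
    have h3 : u * star u = (Complex.normSq u : ℂ) := Complex.mul_conj u
    rw [h3] at h2 ⊢
    norm_cast at h2 ⊢
    exact (pow_eq_one_iff_of_nonneg (Complex.normSq_nonneg u) two_ne_zero).1 h2
  obtain ⟨A, hA⟩ : ∃ A : SL2C, A.1 = !![u, 0; 0, star u] := ⟨⟨_, by simpa using hn⟩, rfl⟩
  rw [Complex.star_def] at hc hn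
  refine ⟨A, ?_⟩
  refine Matrix.ext_of_mulVec_single fun j => ?_
  rw [lorentzMatrix_mulVec_eq_iff, coe_toHerm, coe_toHerm, hA]
  ext a b
  fin_cases j <;> fin_cases a <;> fin_cases b <;>
    simp [Matrix.mul_apply, Fin.sum_univ_two, c00, c10, c20, c30, c03, c13, c23, c33, r01, r02,
      r31, r32, e22, e12]
  · exact hn
  · linear_combination hn
  · linear_combination hu
  · linear_combination hc
  · linear_combination Complex.I * hu + (M 2 1 : ℂ) * Complex.I_sq
  · linear_combination -Complex.I * hc + (M 2 1 : ℂ) * Complex.I_sq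
  · exact hn
  · linear_combination hn

/-- Such an `M` sends e₃ to a unit spatial vector n. Some `U` fixes e₀ and also sends e₃ to n, and
undoing it leaves a rotation about the z axis. -/
theorem exists_lorentzMatrix_eq_of_fix_zero {M : Matrix (Fin 4) (Fin 4) ℝ}
    (h : Mᵀ * eta * M = eta) (hdet : 0 < M.det) (h0 : M *ᵥ Pi.single 0 1 = Pi.single 0 1) :
    ∃ A, lorentzMatrix A = M := by
  obtain ⟨U, hU0, hU3⟩ : ∃ U : SL2C, lorentzMatrix U *ᵥ Pi.single 0 1 = Pi.single 0 1 ∧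
      lorentzMatrix U *ᵥ Pi.single 3 1 = M *ᵥ Pi.single 3 1 := by
    have c0 : ∀ i, M i 0 = (Pi.single 0 1 : Fin 4 → ℝ) i := fun i => by simpa using congrFun h0 i
    have c00 := c0 0
    have c10 := c0 1
    have c20 := c0 2
    have c30 := c0 3
    simp at c00 c10 c20 c30
    have r03 := lorentz_col_mul_col h 0 3
    have r33 := lorentz_col_mul_col h 3 3
    simp [eta, c00, c10, c20, c30] at r03
    simp [eta, r03] at r33
    simp only [lorentzMatrix_mulVec_eq_iff, coe_toHerm]
    -- If n is antipodal to e₃, a half-turn serves. Otherwise `U` = c(1 + Nσ), with N and σ the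
    -- Hermitian matrices of n and e₃, and `c` normalizes the determinant to 1; this formula
    -- degenerates exactly at n = -e₃.
    by_cases hz : M 3 3 = -1
    · have hxy : M 1 3 * M 1 3 + M 2 3 * M 2 3 = 0 := by rw [hz] at r33; linarith
      obtain ⟨hx, hy⟩ :=
        (add_eq_zero_iff_of_nonneg (mul_self_nonneg _) (mul_self_nonneg _)).1 hxy
      rw [mul_self_eq_zero] at hx hy
      obtain ⟨U, hU⟩ : ∃ U : SL2C, U.1 = !![0, 1; -1, 0] := ⟨⟨_, by simp⟩, rfl⟩
      refine ⟨U, ?_, ?_⟩ <;> rw [hU] <;> ext a b <;> fin_cases a <;> fin_cases b <;>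
        simp [Matrix.mul_apply, Fin.sum_univ_two, r03, hx, hy, hz]
    · have hz1 : 0 < 1 + M 3 3 := by
        refine lt_of_le_of_ne ?_ fun h => hz (by linarith)
        nlinarith [mul_self_nonneg (M 1 3), mul_self_nonneg (M 2 3)]
      obtain ⟨c, hc⟩ : ∃ c : ℝ, c ^ 2 * (2 * (1 + M 3 3)) = 1 :=
        ⟨(√(2 * (1 + M 3 3)))⁻¹, by rw [inv_pow, Real.sq_sqrt (by linarith)]; field_simp⟩
      have hc' := congrArg (fun x : ℝ => (x : ℂ)) hc
      have r33' := congrArg (fun x : ℝ => (x : ℂ)) r33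
      push_cast at hc' r33'
      obtain ⟨U, hU⟩ : ∃ U : SL2C, U.1 =
          !![c * (1 + M 3 3 : ℂ), -(c * (M 1 3 + Complex.I * M 2 3));
            c * (M 1 3 - Complex.I * M 2 3), c * (1 + M 3 3 : ℂ)] := ⟨⟨_, by
        rw [Matrix.det_fin_two_of]
        linear_combination hc' + (c : ℂ) ^ 2 * r33' - (c : ℂ) ^ 2 * (M 2 3 : ℂ) ^ 2 *
          Complex.I_sq⟩, rfl⟩
      refine ⟨U, ?_, ?_⟩ <;> rw [hU] <;> ext a b <;> fin_cases a <;> fin_cases b <;>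
        simp [Matrix.mul_apply, Fin.sum_univ_two, r03]
      · linear_combination hc' + c ^ 2 * r33' - c ^ 2 * M 2 3 ^ 2 * Complex.I_sq
      · ring
      · ring
      · linear_combination hc' + c ^ 2 * r33' - c ^ 2 * M 2 3 ^ 2 * Complex.I_sq
      · linear_combination M 3 3 * hc' - c ^ 2 * r33' + c ^ 2 * M 2 3 ^ 2 * Complex.I_sq
      · linear_combination (M 1 3 + Complex.I * M 2 3) * hc'
      · linear_combination (M 1 3 - Complex.I * M 2 3) * hc'
      · linear_combination -M 3 3 * hc' + c ^ 2 * r33' - c ^ 2 * M 2 3 ^ 2 * Complex.I_sq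
  refine exists_lorentzMatrix_eq_of_inv_mul (A := U) ?_
  refine exists_lorentzMatrix_eq_of_fix_zero_three (lorentzMatrix_mul_transpose_mul_eta_mul _ h)
    ?_ ?_ ?_
  · rw [Matrix.det_mul]
    exact mul_pos (det_lorentzMatrix_pos _) hdet
  · rw [← Matrix.mulVec_mulVec, h0, lorentzMatrix_inv_mulVec_eq hU0]
  · rw [← Matrix.mulVec_mulVec, lorentzMatrix_inv_mulVec_eq hU3]

/-- The vector e₀ corresponds to the identity matrix, so B must satisfy B B† = H, where H is the
Hermitian matrix of M e₀. As M e₀ lies on the upper sheet of the unit hyperboloid, H is positive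
definite of determinant 1, and its Cholesky factor is such a B. -/
theorem exists_lorentzMatrix_eq {M : Matrix (Fin 4) (Fin 4) ℝ}
    (h : Mᵀ * eta * M = eta) (hdet : 0 < M.det) (h00 : 0 < M 0 0) : ∃ A, lorentzMatrix A = M := by
  obtain ⟨B, hB⟩ : ∃ B : SL2C, lorentzMatrix B *ᵥ Pi.single 0 1 = M *ᵥ Pi.single 0 1 := by
    have r00 := lorentz_col_mul_col h 0 0
    simp [eta] at r00
    -- The product (t + z)(t - z) = 1 + x² + y² and the sum 2t of the two factors are positive, so
    -- both factors are.
    have hp : 0 < M 0 0 + M 3 0 := by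
      nlinarith [mul_self_nonneg (M 1 0), mul_self_nonneg (M 2 0)]
    obtain ⟨s, hs0, hs⟩ : ∃ s : ℝ, s ≠ 0 ∧ s ^ 2 = M 0 0 + M 3 0 :=
      ⟨√(M 0 0 + M 3 0), (Real.sqrt_pos.2 hp).ne', Real.sq_sqrt hp.le⟩
    have hs0' : (s : ℂ) ≠ 0 := Complex.ofReal_ne_zero.2 hs0
    have hs' := congrArg (fun x : ℝ => (x : ℂ)) hs
    have r00' := congrArg (fun x : ℝ => (x : ℂ)) r00
    push_cast at hs' r00'
    obtain ⟨B, hB⟩ : ∃ B : SL2C, B.1 = !![(s : ℂ), 0; (M 1 0 - Complex.I * M 2 0) / s, 1 / s] :=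
      ⟨⟨_, by
        rw [Matrix.det_fin_two_of]
        field_simp
        ring⟩, rfl⟩
    refine ⟨B, ?_⟩
    rw [lorentzMatrix_mulVec_eq_iff, coe_toHerm, coe_toHerm, hB]
    ext a b
    fin_cases a <;> fin_cases b <;> simp [Matrix.mul_apply, Fin.sum_univ_two]
    · linear_combination hs'
    · field_simp
    · field_simp
    · field_simp
      linear_combination r00' - M 2 0 ^ 2 * Complex.I_sq - (M 0 0 - M 3 0) * hs'
  refine exists_lorentzMatrix_eq_of_inv_mul (A := B) ?_
  refine exists_lorentzMatrix_eq_of_fix_zero (lorentzMatrix_mul_transpose_mul_eta_mul _ h) ?_ ?_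
  · rw [Matrix.det_mul]
    exact mul_pos (det_lorentzMatrix_pos _) hdet
  · rw [← Matrix.mulVec_mulVec, lorentzMatrix_inv_mulVec_eq hB]

theorem surjective_spinHom : Function.Surjective spinHom := by
  rintro ⟨_, g, hg, rfl⟩
  obtain ⟨A, hA⟩ := exists_lorentzMatrix_eq g.2 (det_pos_of_mem_connectedComponentOfOne hg)
    (zero_zero_pos_of_mem_connectedComponentOfOne hg)
  exact ⟨A, Subtype.ext (Units.ext hA)⟩

/-! ### Smooth maps between embedded spaces -/

/-- The composition of smooth maps is smooth. -/
theorem SmoothOn.comp {S T R E F G : Type*} [NormedAddCommGroup E] [NormedSpace ℝ E]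
    [NormedAddCommGroup F] [NormedSpace ℝ F] [NormedAddCommGroup G] [NormedSpace ℝ G]
    {ι : S → E} {κ : T → F} {μ : R → G} {f : S → T} {g : T → R} {s : Set S} {t : Set T}
    (hg : SmoothOn κ μ g t) (hf : SmoothOn ι κ f s) (hst : MapsTo f s t) :
    SmoothOn ι μ (g ∘ f) s := by
  intro x hx
  obtain ⟨U, hU, hxU, F', hF', hFf⟩ := hf x hx
  obtain ⟨V, hV, hxV, G', hG', hGg⟩ := hg (f x) (hst hx)
  refine ⟨U ∩ F' ⁻¹' V, hF'.continuousOn.isOpen_inter_preimage hU hV,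
    ⟨hxU, by rwa [mem_preimage, ← hFf x hx hxU]⟩, G' ∘ F',
    hG'.comp (hF'.mono inter_subset_left) inter_subset_right, fun y hy hyU => ?_⟩
  rw [Function.comp_apply, hGg _ (hst hy) (by rw [hFf y hy hyU.1]; exact hyU.2),
    hFf y hy hyU.1, Function.comp_apply]

theorem SmoothOn.mono {S T E F : Type*} [NormedAddCommGroup E] [NormedSpace ℝ E]
    [NormedAddCommGroup F] [NormedSpace ℝ F] {ι : S → E} {κ : T → F} {f : S → T} {s t : Set S}
    (hf : SmoothOn ι κ f t) (hst : s ⊆ t) : SmoothOn ι κ f s := fun x hx =>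
  let ⟨U, hU, hxU, G, hG, h⟩ := hf x (hst hx)
  ⟨U, hU, hxU, G, hG, fun y hy => h y (hst hy)⟩

/-- A map which is the restriction of a globally smooth map is smooth. -/
theorem SmoothOn.of_contDiff {S T E F : Type*} [NormedAddCommGroup E] [NormedSpace ℝ E]
    [NormedAddCommGroup F] [NormedSpace ℝ F] {ι : S → E} {κ : T → F} {f : S → T} {G : E → F}
    (hG : ContDiff ℝ ∞ G) (h : ∀ y, κ (f y) = G (ι y)) (s : Set S) : SmoothOn ι κ f s :=
  fun _ _ => ⟨univ, isOpen_univ, mem_univ _, G, hG.contDiffOn, fun y _ _ => h y⟩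

theorem smoothOn_mul_left_SL2C (A : SL2C) (s : Set SL2C) :
    SmoothOn slEntries slEntries (A * ·) s :=
  .of_contDiff (G := fun (M : Fin 2 → Fin 2 → ℂ) i j => ∑ k, A.1 i k * M k j)
    (contDiff_pi.2 fun _ => contDiff_pi.2 fun j => ContDiff.sum fun k _ =>
      contDiff_const.mul (contDiff_apply_apply ℝ ℂ k j)) (fun _ => rfl) s

theorem smoothOn_mul_left_SOplus (Λ : SOplus) (s : Set SOplus) :
    SmoothOn soEntries soEntries (Λ * ·) s :=
  .of_contDiff (G := fun (M : Fin 4 → Fin 4 → ℝ) i j => ∑ k, soEntries Λ i k * M k j)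
    (contDiff_pi.2 fun _ => contDiff_pi.2 fun j => ContDiff.sum fun k _ =>
      contDiff_const.mul (contDiff_apply_apply ℝ ℝ k j)) (fun _ => rfl) s

theorem smoothOn_dagger (s : Set SL2C) : SmoothOn slEntries slEntries dagger s :=
  .of_contDiff (G := fun (M : Fin 2 → Fin 2 → ℂ) i j => star (M j i))
    (contDiff_pi.2 fun i => contDiff_pi.2 fun j =>
      (starL' ℝ : ℂ ≃L[ℝ] ℂ).contDiff.comp (contDiff_apply_apply ℝ ℂ j i)) (fun _ => rfl) s

theorem continuous_soEntries : Continuous soEntries :=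
  continuous_pi fun i => continuous_pi fun j =>
    (Units.continuous_val.comp (continuous_subtype_val : Continuous fun Λ : SOplus => Λ.1)
      ).matrix_elem i j

/-! ### The explicit local inverse and the kernel -/

/-- The twisted trace `½ ∑ μ, L(e_μ) σ_μ`, which sends the Lorentz transformation of `A` to
`conj (tr A) • A`. -/
noncomputable def twistedTrace (L : Fin 4 → Fin 4 → ℝ) : Matrix (Fin 2) (Fin 2) ℂ :=
  (2⁻¹ : ℂ) • ∑ j, (toHerm fun i => L i j).1 * (toHerm (Pi.single j 1)).1

theorem sum_toHerm_single_mul_mul (K : Matrix (Fin 2) (Fin 2) ℂ) :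
    ∑ j : Fin 4, (toHerm (Pi.single j 1)).1 * K * (toHerm (Pi.single j 1)).1 =
      (2 * K.trace) • 1 := by
  simp only [coe_toHerm, Fin.sum_univ_four, Matrix.trace_fin_two]
  rw [K.eta_fin_two]
  ext a b
  fin_cases a <;> fin_cases b <;> simp
  · linear_combination -K 1 1 * Complex.I_sq
  · linear_combination K 1 0 * Complex.I_sq
  · linear_combination K 0 1 * Complex.I_sq
  · linear_combination -K 0 0 * Complex.I_sq

/-- The summands are A σ_j A† σ_j. Pulling out A leaves the sum ∑ σ_j K σ_j = 2 tr K at K = A†. -/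
theorem twistedTrace_spinHom (A : SL2C) :
    twistedTrace (soEntries (spinHom A)) = star A.1.trace • A.1 := by
  have h : ∀ j, (toHerm fun i => soEntries (spinHom A) i j).1 =
      A.1 * (toHerm (Pi.single j 1)).1 * A.1ᴴ := fun j => by
    rw [← coe_toHerm_lorentzMatrix_mulVec, Matrix.mulVec_single_one]
    rfl
  have hs := sum_toHerm_single_mul_mul A.1ᴴ
  simp only [twistedTrace, h]
  simp only [Matrix.mul_assoc, ← Finset.mul_sum] at hs ⊢
  rw [hs, Matrix.mul_smul, Matrix.mul_one, smul_smul, ← mul_assoc, inv_mul_cancel₀ two_ne_zero,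
    one_mul, Matrix.trace_conjTranspose]

theorem det_twistedTrace_spinHom (A : SL2C) :
    (twistedTrace (soEntries (spinHom A))).det = star A.1.trace ^ 2 := by
  rw [twistedTrace_spinHom, Matrix.det_smul, A.2, mul_one, Fintype.card_fin]

theorem contDiff_twistedTrace_apply (a b : Fin 2) :
    ContDiff ℝ ∞ fun L : Fin 4 → Fin 4 → ℝ => twistedTrace L a b := by
  have hr : ∀ i j, ContDiff ℝ ∞ fun L : Fin 4 → Fin 4 → ℝ => (L i j : ℂ) := fun i j =>
    Complex.ofRealCLM.contDiff.comp (contDiff_apply_apply ℝ ℝ i j)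
  have hh : ∀ j a b, ContDiff ℝ ∞ fun L : Fin 4 → Fin 4 → ℝ =>
      (toHerm fun i => L i j).1 a b := fun j a b => by
    fin_cases a <;> fin_cases b
    · exact (hr 0 j).add (hr 3 j)
    · exact (hr 1 j).add (contDiff_const.mul (hr 2 j))
    · exact (hr 1 j).sub (contDiff_const.mul (hr 2 j))
    · exact (hr 0 j).sub (hr 3 j)
  simp only [twistedTrace, Matrix.smul_apply, Matrix.sum_apply, Matrix.mul_apply, smul_eq_mul]
  exact contDiff_const.mul <| ContDiff.sum fun j _ => ContDiff.sum fun k _ =>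
    (hh j a k).mul contDiff_const

/-- The explicit local inverse of the spin homomorphism. -/
noncomputable def spinLift (L : Fin 4 → Fin 4 → ℝ) : Matrix (Fin 2) (Fin 2) ℂ :=
  Complex.exp (-(Complex.log (twistedTrace L).det / 2)) • twistedTrace L

/-- The determinant of the twisted trace is conj(tr A)², and for Re tr A > 0 its principal square
root is conj(tr A) itself, so dividing by it recovers A. -/
theorem spinLift_spinHom {A : SL2C} (hA : 0 < A.1.trace.re) :
    spinLift (soEntries (spinHom A)) = A.1 := by
  have h : 0 < (star A.1.trace).re := by simpa using hA
  have h0 : star A.1.trace ≠ 0 := fun h' => by simp [h'] at h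
  have h1 : Complex.exp (Complex.log (star A.1.trace ^ 2) / 2) = star A.1.trace := by
    conv_rhs => rw [← Complex.sq_cpow_two_inv h, Complex.cpow_def_of_ne_zero (pow_ne_zero 2 h0)]
    rfl
  rw [spinLift, det_twistedTrace_spinHom, twistedTrace_spinHom, Complex.exp_neg, h1, smul_smul,
    inv_mul_cancel₀ h0, one_smul]

theorem contDiff_det_twistedTrace : ContDiff ℝ ∞ fun L => (twistedTrace L).det := by
  simp only [Matrix.det_fin_two]
  exact ((contDiff_twistedTrace_apply 0 0).mul (contDiff_twistedTrace_apply 1 1)).sub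
    ((contDiff_twistedTrace_apply 0 1).mul (contDiff_twistedTrace_apply 1 0))

theorem contDiffOn_spinLift :
    ContDiffOn ℝ ∞ (fun L => (fun i j => spinLift L i j : Fin 2 → Fin 2 → ℂ))
      {L | (twistedTrace L).det ∈ Complex.slitPlane} := by
  have hlog : ContDiffOn ℝ ∞ (fun L => Complex.log (twistedTrace L).det)
      {L | (twistedTrace L).det ∈ Complex.slitPlane} := fun L hL =>
    (ContDiffAt.comp L (g := Complex.log) ((Complex.contDiffAt_log hL).restrict_scalars ℝ)
      contDiff_det_twistedTrace.contDiffAt).contDiffWithinAt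
  exact contDiffOn_pi.2 fun i => contDiffOn_pi.2 fun j =>
    ((Complex.contDiff_exp (𝕜 := ℝ)).comp_contDiffOn (hlog.div_const 2).neg).mul
      (contDiff_twistedTrace_apply i j).contDiffOn

theorem isOpen_det_twistedTrace_mem_slitPlane :
    IsOpen {L | (twistedTrace L).det ∈ Complex.slitPlane} :=
  Complex.isOpen_slitPlane.preimage contDiff_det_twistedTrace.continuous

theorem spinHom_eq_one_iff (A : SL2C) : spinHom A = 1 ↔ A = 1 ∨ A = -1 := by
  refine ⟨fun h => ?_, ?_⟩
  · have h1 := twistedTrace_spinHom A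
    have h2 := det_twistedTrace_spinHom A
    have h3 := twistedTrace_spinHom 1
    have h4 := det_twistedTrace_spinHom 1
    rw [map_one] at h3 h4
    rw [h, h3] at h1
    rw [h, h4] at h2
    have ht : star (1 : SL2C).1.trace = 2 := by
      change star (1 : Matrix (Fin 2) (Fin 2) ℂ).trace = 2
      simp
    rw [ht] at h1 h2
    have h1' : (2 : ℂ) • (1 : Matrix (Fin 2) (Fin 2) ℂ) = star A.1.trace • A.1 := h1
    -- Comparing twisted traces with those of the identity gives conj(tr A) = ±2 and conj(tr A) • A
    -- = 2 • 1, hence A = ±1.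
    rcases sq_eq_sq_iff_eq_or_eq_neg.1 h2.symm with h5 | h5
    · rw [h5] at h1'
      exact Or.inl (Subtype.ext (smul_right_injective _ (two_ne_zero (α := ℂ)) h1').symm)
    · rw [h5, neg_smul, ← smul_neg] at h1'
      exact Or.inr (Subtype.ext (neg_eq_iff_eq_neg.1
        (smul_right_injective _ (two_ne_zero (α := ℂ)) h1').symm))
  · rintro (rfl | rfl)
    · exact map_one _
    · refine Subtype.ext (Units.ext (matrix_eq_of_toHerm_mulVec_eq fun v => Subtype.ext ?_))
      rw [coe_spinHom, coe_toHerm_lorentzMatrix_mulVec]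
      have h : (-1 : SL2C).1 = -1 := rfl
      rw [h]
      simp

theorem spinHom_neg (A : SL2C) : spinHom (-A) = spinHom A := by
  rw [← neg_one_mul, map_mul, (spinHom_eq_one_iff (-1)).2 (Or.inr rfl), one_mul]

/-- A square is a nonpositive real exactly when its root is purely imaginary. This turns the branch
cut of the logarithm into the condition Re tr A ≠ 0. -/
theorem sq_mem_slitPlane_iff {w : ℂ} : w ^ 2 ∈ Complex.slitPlane ↔ w.re ≠ 0 := by
  rw [Complex.mem_slitPlane_iff, pow_two, Complex.mul_re, Complex.mul_im]
  constructor
  · rintro h h0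
    rw [h0] at h
    simp only [mul_zero, zero_mul, zero_sub, add_zero, ne_eq, not_true_eq_false, or_false] at h
    linarith [mul_self_nonneg w.im]
  · intro h
    by_cases h0 : w.im = 0
    · left
      rw [h0, mul_zero, sub_zero]
      exact mul_self_pos.2 h
    · right
      rw [mul_comm w.im, ← two_mul]
      exact mul_ne_zero two_ne_zero (mul_ne_zero h h0)

theorem det_twistedTrace_spinHom_mem_slitPlane_iff (A : SL2C) :
    (twistedTrace (soEntries (spinHom A))).det ∈ Complex.slitPlane ↔ A.1.trace.re ≠ 0 := by
  rw [det_twistedTrace_spinHom, sq_mem_slitPlane_iff]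
  simp

theorem exists_spinHom_eq_of_det_mem_slitPlane {Λ : SOplus}
    (hΛ : (twistedTrace (soEntries Λ)).det ∈ Complex.slitPlane) :
    ∃ A : SL2C, 0 < A.1.trace.re ∧ spinHom A = Λ := by
  obtain ⟨A, rfl⟩ := surjective_spinHom Λ
  rcases ((det_twistedTrace_spinHom_mem_slitPlane_iff A).1 hΛ).lt_or_gt with h | h
  · refine ⟨-A, ?_, spinHom_neg A⟩
    change 0 < (-A.1).trace.re
    rw [Matrix.trace_neg, Complex.neg_re]
    linarith
  · exact ⟨A, h, rfl⟩

open scoped Classical in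
/-- The explicit local inverse of the spin homomorphism, with values in `SL(2, ℂ)`. -/
noncomputable def spinInv (Λ : SOplus) : SL2C :=
  if h : (spinLift (soEntries Λ)).det = 1 then (⟨_, h⟩ : SL2C) else 1

theorem spinInv_spinHom {A : SL2C} (hA : 0 < A.1.trace.re) : spinInv (spinHom A) = A := by
  have h := spinLift_spinHom hA
  have hdet : (spinLift (soEntries (spinHom A))).det = 1 := by
    rw [h]
    exact A.2
  exact (dif_pos hdet).trans (Subtype.ext h)

theorem coe_spinInv {Λ : SOplus} (hΛ : (twistedTrace (soEntries Λ)).det ∈ Complex.slitPlane) :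
    (spinInv Λ).1 = spinLift (soEntries Λ) := by
  obtain ⟨A, hA, rfl⟩ := exists_spinHom_eq_of_det_mem_slitPlane hΛ
  rw [spinInv_spinHom hA, spinLift_spinHom hA]

/-- The spin homomorphism as a homeomorphism from the matrices with trace in the right half plane
onto its image. -/
noncomputable def spinPartialHomeomorph : OpenPartialHomeomorph SL2C SOplus where
  toFun := spinHom
  invFun := spinInv
  source := {A | 0 < A.1.trace.re}
  target := {Λ | (twistedTrace (soEntries Λ)).det ∈ Complex.slitPlane}
  map_source' A hA := (det_twistedTrace_spinHom_mem_slitPlane_iff A).2 (ne_of_gt hA)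
  map_target' Λ hΛ := by
    obtain ⟨A, hA, rfl⟩ := exists_spinHom_eq_of_det_mem_slitPlane hΛ
    rwa [spinInv_spinHom hA]
  left_inv' A hA := spinInv_spinHom hA
  right_inv' Λ hΛ := by
    obtain ⟨A, hA, rfl⟩ := exists_spinHom_eq_of_det_mem_slitPlane hΛ
    rw [spinInv_spinHom hA]
  open_source := isOpen_lt continuous_const <| Complex.continuous_re.comp
    (continuous_subtype_val : Continuous fun A : SL2C => A.1).matrix_trace
  open_target := isOpen_det_twistedTrace_mem_slitPlane.preimage continuous_soEntries
  continuousOn_toFun := continuous_spinHom.continuousOn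
  continuousOn_invFun := by
    refine IsEmbedding.subtypeVal.continuousOn_iff.2 ?_
    exact (contDiffOn_spinLift.continuousOn.comp continuous_soEntries.continuousOn
      fun _ h => h).congr fun Λ hΛ => coe_spinInv hΛ

theorem smoothOn_spinPartialHomeomorph_symm :
    SmoothOn soEntries slEntries spinPartialHomeomorph.symm spinPartialHomeomorph.target :=
  fun _ hΛ => ⟨_, isOpen_det_twistedTrace_mem_slitPlane, hΛ, _, contDiffOn_spinLift,
    fun _ h _ => funext fun i => funext fun j => congrFun (congrFun (coe_spinInv h) i) j⟩

/-! ### Local diffeomorphism and covering map -/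

theorem isLocalDiffeo_spinHom : IsLocalDiffeo spinHom := fun A => by
  -- The chart at 1 is transported to `A` through `spinHom` B = `spinHom` A * `spinHom` (A⁻¹ * B).
  let e := (Homeomorph.mulLeft A).symm.toOpenPartialHomeomorph.trans
    (spinPartialHomeomorph.trans (Homeomorph.mulLeft (spinHom A)).toOpenPartialHomeomorph)
  have he : ∀ B, e B = spinHom B := fun B => by
    change spinHom A * spinHom (A⁻¹ * B) = spinHom B
    rw [← map_mul, mul_inv_cancel_left]
  have heq : ⇑e = spinHom := funext he
  refine ⟨e, ?_, fun B _ => (he B).symm, ?_, ?_⟩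
  · have h : 0 < ((A⁻¹ * A : SL2C).1).trace.re := by
      rw [inv_mul_cancel]
      change 0 < (1 : Matrix (Fin 2) (Fin 2) ℂ).trace.re
      simp
    exact ⟨mem_univ _, h, mem_univ _⟩
  · rw [heq]
    exact isSmooth_spinHom.mono (subset_univ _)
  · have h1 := smoothOn_mul_left_SOplus (spinHom A)⁻¹ e.target
    have h2 := smoothOn_spinPartialHomeomorph_symm.comp h1 fun Λ hΛ => by
      simpa [e] using! hΛ
    exact (smoothOn_mul_left_SL2C A univ).comp h2 (mapsTo_univ _ _)

theorem isLocalHomeomorph_of_isLocalDiffeo {p : SL2C → SOplus} (hp : IsLocalDiffeo p) :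
    IsLocalHomeomorph p :=
  IsLocalHomeomorph.mk p fun A =>
    let ⟨e, hA, he, _⟩ := hp A
    ⟨e, hA, he⟩

theorem isCoveringMap_spinHom : IsCoveringMap spinHom := by
  have hl := isLocalHomeomorph_of_isLocalDiffeo isLocalDiffeo_spinHom
  -- A quotient homomorphism with discrete kernel is a covering map; here the kernel is finite.
  have hq : IsQuotientMap spinHom :=
    hl.isOpenMap.isQuotientMap hl.continuous surjective_spinHom
  refine (hq.isQuotientCoveringMap_of_isDiscrete_ker_monoidHom ?_).isCoveringMap
  have hfin : (spinHom.ker : Set SL2C).Finite :=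
    (Set.toFinite {1, -1}).subset fun A hA => (spinHom_eq_one_iff A).1 hA
  exact hfin.isDiscrete

theorem isUniversalCover_spinHom : IsUniversalCover spinHom :=
  ⟨simplyConnectedSpace_SL2C, surjective_spinHom, isCoveringMap_spinHom, isLocalDiffeo_spinHom⟩

/-! ### Transfer along the conjugate transpose -/

theorem continuous_dagger : Continuous dagger :=
  (continuous_subtype_val : Continuous fun A : SL2C => A.1).matrix_conjTranspose.subtype_mk _

/-- The conjugate transpose as a homeomorphism of `SL(2, ℂ)`. -/
def daggerHomeomorph : SL2C ≃ₜ SL2C where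
  toFun := dagger
  invFun := dagger
  left_inv := dagger_dagger
  right_inv := dagger_dagger
  continuous_toFun := continuous_dagger
  continuous_invFun := continuous_dagger

theorem IsLocalDiffeo.comp_dagger {p : SL2C → SOplus} (hp : IsLocalDiffeo p) :
    IsLocalDiffeo (p ∘ dagger) := fun A => by
  obtain ⟨e, hA, he, hs, hs'⟩ := hp (dagger A)
  refine ⟨daggerHomeomorph.toOpenPartialHomeomorph.trans e, ?_, ?_, ?_, ?_⟩
  · exact ⟨mem_univ _, hA⟩
  · intro B hB
    exact he hB.2
  · exact hs.comp (smoothOn_dagger _) fun B hB => hB.2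
  · exact (smoothOn_dagger univ).comp (hs'.mono (by simp)) (mapsTo_univ _ _)

theorem IsUniversalCover.comp_dagger {p : SL2C → SOplus} (hp : IsUniversalCover p) :
    IsUniversalCover (p ∘ dagger) :=
  ⟨hp.simplyConnected, hp.surjective.comp daggerHomeomorph.surjective,
    hp.isCoveringMap.comp_homeomorph daggerHomeomorph, hp.isLocalDiffeo.comp_dagger⟩

end SpinCover

theorem mainTheorem6 :
    ∃ p : SpinCover.SL2C → SpinCover.SOplus,
      -- `p A` is the action `X ↦ A† X A` read on Minkowski space
      (∀ (A : SpinCover.SL2C) (v : Fin 4 → ℝ),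
        SpinCover.toHerm (((p A : GL (Fin 4) ℝ) : Matrix (Fin 4) (Fin 4) ℝ) *ᵥ v) =
          SpinCover.hermAction A (SpinCover.toHerm v)) ∧
      p 1 = 1 ∧
      (∀ A B : SpinCover.SL2C, p (A * B) = p B * p A) ∧
      SpinCover.IsSmooth p ∧
      {A : SpinCover.SL2C | p A = 1} = {1, -1} ∧
      SpinCover.IsUniversalCover p ∧
      -- `A ↦ p (A†)`, the action `X ↦ A X A†`, is a group homomorphism and the universal cover
      ∃ φ : SpinCover.SL2C →* SpinCover.SOplus,
        (∀ A : SpinCover.SL2C, φ A = p (SpinCover.dagger A)) ∧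
        SpinCover.IsSmooth φ ∧
        (φ.ker : Set SpinCover.SL2C) = {1, -1} ∧
        SpinCover.IsUniversalCover φ := by
  refine ⟨SpinCover.spinHom ∘ SpinCover.dagger, fun A v => ?_, ?_, fun A B => ?_, ?_, ?_,
    SpinCover.isUniversalCover_spinHom.comp_dagger, SpinCover.spinHom, fun A => ?_,
    SpinCover.isSmooth_spinHom, ?_, SpinCover.isUniversalCover_spinHom⟩
  · rw [Function.comp_apply, SpinCover.coe_spinHom, SpinCover.toHerm_lorentzMatrix_mulVec,
      SpinCover.dagger_dagger]
  · rw [Function.comp_apply, SpinCover.dagger_one, map_one]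
  · simp only [Function.comp_apply, SpinCover.dagger_mul, map_mul]
  · exact SpinCover.isSmooth_spinHom.comp (SpinCover.smoothOn_dagger _) (Set.mapsTo_univ _ _)
  · ext A
    rw [Set.mem_ofPred_eq, Function.comp_apply, SpinCover.spinHom_eq_one_iff, Set.mem_insert_iff,
      Set.mem_singleton_iff, ← SpinCover.daggerHomeomorph.injective.eq_iff (a := A),
      ← SpinCover.daggerHomeomorph.injective.eq_iff (a := A) (b := -1)]
    change _ ↔ SpinCover.dagger A = SpinCover.dagger 1 ∨
      SpinCover.dagger A = SpinCover.dagger (-1)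
    rw [SpinCover.dagger_one, SpinCover.dagger_neg_one]
  · rw [Function.comp_apply, SpinCover.dagger_dagger]
  · ext A
    exact SpinCover.spinHom_eq_one_iff A
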